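/- Let $\mathbb{k}$ be an algebraically closed field of characteristic $p$ and let $H$ be a finite dimensional semisimple Hopf algebra over $\mathbb{k}$ with antipode $S$, such that $p>\dim_{\mathbb{k}}(H)^{1/2}$. Let $\Lambda\in H$ be a nonzero left integral of $H$, i.e. $h\Lambda=\varepsilon(h)\Lambda$ for all $h\in H$, and let $\lambda\in H^*$ be a nonzero right integral of the dual Hopf algebra $H^*$, i.e. $\lambda f=f(1)\lambda$ for all $f\in H^*$. An element $c$ of a coalgebra is called cocommutative if $c_{(1)}\otimes c_{(2)}=c_{(2)}\otimes c_{(1)}$. Then the following three statements are equivalent: (1) $\Lambda$ is cocommutative in $H$; (2) $\lambda$ is cocommutative in $H^*$; (3) $S^2=\mathrm{id}$. -/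

import Mathlib

open scoped TensorProduct

/-- `Λ` is a left integral of the Hopf algebra `H`: `h Λ = ε(h) Λ` for all `h ∈ H`. -/
def IsLeftIntegral (k : Type*) {H : Type*} [CommSemiring k] [Semiring H] [HopfAlgebra k H]
    (Λ : H) : Prop :=
  ∀ h : H, h * Λ = Coalgebra.counit (R := k) h • Λ

/-- `lam` is a right integral of the dual `H*`: `lam * f = f(1) lam` for all `f ∈ H*`.
The product of `H*` is the convolution product, and its counit is evaluation at `1`. -/
def IsRightIntegralDual {k H : Type*} [CommSemiring k] [Semiring H] [HopfAlgebra k H]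
    (lam : Module.Dual k H) : Prop :=
  ∀ f : Module.Dual k H,
    WithConv.toConv lam * WithConv.toConv f = f 1 • WithConv.toConv lam

/-- The comultiplication of the dual `H*` of a finite dimensional Hopf algebra: the transpose
`H* → (H ⊗ H)*` of the multiplication of `H`, followed by the inverse of the canonical isomorphism
`H* ⊗ H* ≅ (H ⊗ H)*`. -/
noncomputable def dualComul (k H : Type*) [Field k] [Ring H] [HopfAlgebra k H]
    [FiniteDimensional k H] :
    Module.Dual k H →ₗ[k] Module.Dual k H ⊗[k] Module.Dual k H :=
  (TensorProduct.dualDistribEquiv k H H).symm.toLinearMap ∘ₗ (LinearMap.mul' k H).dualMap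

/-- The comultiplication of `H*` is characterised by `f₍₁₎(a) f₍₂₎(b) = f(ab)`. -/
theorem dualDistrib_dualComul {k H : Type*} [Field k] [Ring H] [HopfAlgebra k H]
    [FiniteDimensional k H] (f : Module.Dual k H) (a b : H) :
    TensorProduct.dualDistrib k H H (dualComul k H f) (a ⊗ₜ[k] b) = f (a * b) := by
  have h : TensorProduct.dualDistribEquiv k H H (dualComul k H f)
      = (LinearMap.mul' k H).dualMap f :=
    LinearEquiv.apply_symm_apply _ _
  exact LinearMap.congr_fun h (a ⊗ₜ[k] b)

/-- An element `c` of a coalgebra with comultiplication `δ` is cocommutative if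
`c₍₁₎ ⊗ c₍₂₎ = c₍₂₎ ⊗ c₍₁₎`. -/
def IsCocommutativeElement {k C : Type*} [CommSemiring k] [AddCommMonoid C] [Module k C]
    (δ : C →ₗ[k] C ⊗[k] C) (c : C) : Prop :=
  TensorProduct.comm k C C (δ c) = δ c

/-!
Write `λ` for the functional `x ↦ Tr(h ↦ S²(h) x)` on `H`. Two normalised integrals carry the proof.

* Since `H` is semisimple, the kernel of the counit has a complementary left ideal, which yields a
  left integral `e` with `ε(e) = 1` (`exists_isLeftIntegral_counit_eq_one`).
* The functional `λ` is a right integral, `λ(x₍₁₎) x₍₂₎ = λ(x) 1`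
  (`isRightIntegralOn_traceIntegral`), and `λ(e) = ε(e) = 1` because `h ↦ S²(h) e = ε(h) e` has rank
  one.

From `e₍₁₎ ⊗ h e₍₂₎ = S(h) e₍₁₎ ⊗ e₍₂₎` follows the dual basis formula `h = λ(S(h) e₍₁₎) e₍₂₎`.
It makes `S` bijective, `e` two-sided, the map `f ↦ f(e₍₁₎) e₍₂₎` injective, and both kinds of
integrals unique up to a scalar. Hence `Λ` and the given integral of `H*` may be replaced by `e` and
`λ`.

Comparing the dual basis formula with `λ(e₍₁₎ h) e₍₂₎ = S(h)` gives `λ(x y) = λ(S²(y) x)`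
(`IsLeftIntegral.traceIntegral_mul_comm`). As `λ` is nondegenerate, it is a trace, that is
cocommutative in `H*`, if and only if `S² = id`.

If `e` is cocommutative, flipping `e₍₁₎ ⊗ h e₍₂₎ = S(h) e₍₁₎ ⊗ e₍₂₎` gives
`h e₍₁₎ ⊗ e₍₂₎ = S²(h) e₍₁₎ ⊗ e₍₂₎`, so `S² = id`. Conversely, if `S² = id`, then `λ(x)` is the
trace of right multiplication by `x`, and evaluating it in the dual bases gives `λ(x) = λ(S(x))`
(`IsLeftIntegral.traceIntegral_antipode`). With the symmetry of `λ` this shows that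
`λ(S(h) e₍₂₎) e₍₁₎ = h`, and comparison with the dual basis formula gives the cocommutativity of
`e`.

The identities in `H ⊗ H` are derived in the convolution algebra of linear maps `H → H ⊗ H`, where
the comultiplication is the product of the two embeddings `a ↦ a ⊗ 1` and `b ↦ 1 ⊗ b`.
-/

open Coalgebra HopfAlgebra WithConv Module

section

variable {k H : Type*} [Field k] [Ring H] [HopfAlgebra k H]

/-! ### Contraction of tensors by functionals -/

/-- The linear map `a ⊗ b ↦ f(a) b`. -/
noncomputable def contractFst (f : Dual k H) : H ⊗[k] H →ₗ[k] H :=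
  (TensorProduct.lid k H).toLinearMap ∘ₗ f.rTensor H

/-- The linear map `a ⊗ b ↦ f(b) a`. -/
noncomputable def contractSnd (f : Dual k H) : H ⊗[k] H →ₗ[k] H :=
  (TensorProduct.rid k H).toLinearMap ∘ₗ f.lTensor H

@[simp]
lemma contractFst_tmul (f : Dual k H) (a b : H) : contractFst f (a ⊗ₜ[k] b) = f a • b := by
  simp [contractFst]

@[simp]
lemma contractSnd_tmul (f : Dual k H) (a b : H) : contractSnd f (a ⊗ₜ[k] b) = f b • a := by
  simp [contractSnd]

lemma contractSnd_comul (g : Dual k H) (y : H) :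
    contractSnd g (comul y) =
      ∑ i ∈ (ℛ k y).index, g ((ℛ k y).right i) • (ℛ k y).left i := by
  conv_lhs => rw [← (ℛ k y).eq, map_sum]
  simp

lemma contractFst_comm (f : Dual k H) (t : H ⊗[k] H) :
    contractFst f (TensorProduct.comm k H H t) = contractSnd f t := by
  induction t with
  | zero => simp
  | tmul a b => simp
  | add s t hs ht => simp only [map_add, hs, ht]

lemma contractFst_mul_left (f : Dual k H) (a b : H) (t : H ⊗[k] H) :
    contractFst f ((a ⊗ₜ[k] b) * t) = b * contractFst (f ∘ₗ LinearMap.mulLeft k a) t := by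
  induction t with
  | zero => simp
  | tmul c d => simp
  | add s t hs ht => simp only [map_add, mul_add, hs, ht]

lemma contractFst_mul_right (f : Dual k H) (a b : H) (t : H ⊗[k] H) :
    contractFst f (t * (a ⊗ₜ[k] b)) = contractFst (f ∘ₗ LinearMap.mulRight k a) t * b := by
  induction t with
  | zero => simp
  | tmul c d => simp
  | add s t hs ht => simp only [map_add, add_mul, hs, ht]

lemma contractSnd_mul_left (f : Dual k H) (a b : H) (t : H ⊗[k] H) :
    contractSnd f ((a ⊗ₜ[k] b) * t) = a * contractSnd (f ∘ₗ LinearMap.mulLeft k b) t := by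
  induction t with
  | zero => simp
  | tmul c d => simp
  | add s t hs ht => simp only [map_add, mul_add, hs, ht]

/-- Contracting the two legs of `t` in either order gives the same scalar `(g ⊗ f)(t)`. -/
lemma apply_contractSnd (f g : Dual k H) (t : H ⊗[k] H) :
    g (contractSnd f t) = f (contractFst g t) := by
  induction t with
  | zero => simp
  | tmul a b => simp [mul_comm]
  | add s t hs ht => simp only [map_add, hs, ht]

/-- A tensor is determined by its contractions in the first leg. -/
lemma ext_contractFst {s t : H ⊗[k] H} (h : ∀ f : Dual k H, contractFst f s = contractFst f t) :
    s = t := by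
  let b := Basis.ofVectorSpace k H
  refine (b.tensorProduct b).ext_elem fun ⟨i, j⟩ => ?_
  have key : ∀ u : H ⊗[k] H,
      (b.tensorProduct b).repr u (i, j) = b.repr (contractFst (b.coord i) u) j := by
    intro u
    induction u with
    | zero => simp
    | tmul x y => simp [Basis.tensorProduct_repr_tmul_apply, mul_comm]
    | add u v hu hv => simp only [map_add, Finsupp.add_apply, hu, hv]
  rw [key, key, h]

/-! ### Convolution identities for the comultiplication and the antipode -/

/-- The embedding `a ↦ a ⊗ 1`, as an element of the convolution algebra `Hom(H, H ⊗ H)`. -/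
noncomputable def convInl (k H : Type*) [Field k] [Ring H] [HopfAlgebra k H] :
    WithConv (H →ₗ[k] H ⊗[k] H) :=
  toConv (Algebra.TensorProduct.includeLeft : H →ₐ[k] H ⊗[k] H).toLinearMap

/-- The embedding `b ↦ 1 ⊗ b`, as an element of the convolution algebra `Hom(H, H ⊗ H)`. -/
noncomputable def convInr (k H : Type*) [Field k] [Ring H] [HopfAlgebra k H] :
    WithConv (H →ₗ[k] H ⊗[k] H) :=
  toConv (Algebra.TensorProduct.includeRight : H →ₐ[k] H ⊗[k] H).toLinearMap

/-- The map `a ↦ S(a) ⊗ 1`. -/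
noncomputable def convInlAntipode (k H : Type*) [Field k] [Ring H] [HopfAlgebra k H] :
    WithConv (H →ₗ[k] H ⊗[k] H) :=
  toConv ((Algebra.TensorProduct.includeLeft : H →ₐ[k] H ⊗[k] H).toLinearMap ∘ₗ antipode k)

/-- The map `b ↦ 1 ⊗ S(b)`. -/
noncomputable def convInrAntipode (k H : Type*) [Field k] [Ring H] [HopfAlgebra k H] :
    WithConv (H →ₗ[k] H ⊗[k] H) :=
  toConv ((Algebra.TensorProduct.includeRight : H →ₐ[k] H ⊗[k] H).toLinearMap ∘ₗ antipode k)

@[simp] lemma convInl_apply (a : H) : convInl k H a = a ⊗ₜ[k] 1 := rfl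
@[simp] lemma convInr_apply (a : H) : convInr k H a = 1 ⊗ₜ[k] a := rfl
@[simp] lemma convInlAntipode_apply (a : H) : convInlAntipode k H a = antipode k a ⊗ₜ[k] 1 := rfl
@[simp] lemma convInrAntipode_apply (a : H) : convInrAntipode k H a = 1 ⊗ₜ[k] antipode k a := rfl

lemma algHom_antipode_convMul {A : Type*} [Ring A] [Algebra k A] (φ : H →ₐ[k] A) :
    toConv (φ.toLinearMap ∘ₗ antipode k) * toConv φ.toLinearMap = 1 := by
  have h := LinearMap.algHom_comp_convMul_distrib φ (toConv (antipode k)) (toConv LinearMap.id)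
  rw [LinearMap.antipode_mul_id] at h
  apply WithConv.ext
  refine Eq.trans h.symm ?_
  ext x
  simp [LinearMap.convOne_def]

lemma algHom_convMul_antipode {A : Type*} [Ring A] [Algebra k A] (φ : H →ₐ[k] A) :
    toConv φ.toLinearMap * toConv (φ.toLinearMap ∘ₗ antipode k) = 1 := by
  have h := LinearMap.algHom_comp_convMul_distrib φ (toConv LinearMap.id) (toConv (antipode k))
  rw [LinearMap.id_mul_antipode] at h
  apply WithConv.ext
  refine Eq.trans h.symm ?_
  ext x
  simp [LinearMap.convOne_def]

lemma convInlAntipode_mul_convInl : convInlAntipode k H * convInl k H = 1 :=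
  algHom_antipode_convMul _

lemma convInrAntipode_mul_convInr : convInrAntipode k H * convInr k H = 1 :=
  algHom_antipode_convMul _

lemma convInr_mul_convInrAntipode : convInr k H * convInrAntipode k H = 1 :=
  algHom_convMul_antipode _

/-- The comultiplication is the convolution product of the two embeddings `H → H ⊗ H`. -/
lemma convInl_mul_convInr :
    convInl k H * convInr k H = toConv (comul : H →ₗ[k] H ⊗[k] H) := by
  ext x
  rw [(ℛ k x).convMul_apply]
  simpa using (ℛ k x).eq

/-- `(S(h₍₁₎) ⊗ 1) Δ(h₍₂₎) = 1 ⊗ h`. -/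
lemma sum_antipode_mul_comul (h : H) :
    ∑ i ∈ (ℛ k h).index, (antipode k ((ℛ k h).left i) ⊗ₜ[k] (1 : H)) * comul ((ℛ k h).right i) =
      (1 : H) ⊗ₜ[k] h := by
  have : convInlAntipode k H * toConv comul = convInr k H := by
    rw [← convInl_mul_convInr, ← mul_assoc, convInlAntipode_mul_convInl, one_mul]
  have := congr($this h)
  rwa [(ℛ k h).convMul_apply] at this

/-- `Δ(h₍₁₎) (1 ⊗ S(h₍₂₎)) = h ⊗ 1`. -/
lemma sum_comul_mul_antipode (h : H) :
    ∑ i ∈ (ℛ k h).index, comul ((ℛ k h).left i) * ((1 : H) ⊗ₜ[k] antipode k ((ℛ k h).right i)) =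
      h ⊗ₜ[k] (1 : H) := by
  have : toConv comul * convInrAntipode k H = convInl k H := by
    rw [← convInl_mul_convInr, mul_assoc, convInr_mul_convInrAntipode, mul_one]
  have := congr($this h)
  rwa [(ℛ k h).convMul_apply] at this

/-- The map `a ⊗ b ↦ S(b) ⊗ S(a)`. -/
noncomputable def swapAntipode (k H : Type*) [Field k] [Ring H] [HopfAlgebra k H] :
    H ⊗[k] H →ₗ[k] H ⊗[k] H :=
  (TensorProduct.comm k H H).toLinearMap ∘ₗ TensorProduct.map (antipode k) (antipode k)

@[simp]
lemma swapAntipode_tmul (a b : H) : swapAntipode k H (a ⊗ₜ[k] b) =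
    antipode k b ⊗ₜ[k] antipode k a := by
  simp [swapAntipode]

lemma swapAntipode_mul (s t : H ⊗[k] H) :
    swapAntipode k H (s * t) = swapAntipode k H t * swapAntipode k H s := by
  induction s with
  | zero => simp
  | add s s' hs hs' => simp only [map_add, add_mul, mul_add, hs, hs']
  | tmul a b =>
    induction t with
    | zero => simp
    | add t t' ht ht' => simp only [map_add, add_mul, mul_add, ht, ht']
    | tmul c d => simp [antipode_mul_antidistrib]

/-- `(1 ⊗ S(h₍₁₎)) (S(h₍₂₎) ⊗ 1) = Δ(S(h))`, since both sides are convolution inverse to the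
comultiplication. -/
lemma convInrAntipode_mul_convInlAntipode :
    convInrAntipode k H * convInlAntipode k H = toConv (comul ∘ₗ antipode k) := by
  refine left_inv_eq_right_inv (a := toConv (comul : H →ₗ[k] H ⊗[k] H)) ?_
    LinearMap.comul_right_inv
  rw [← convInl_mul_convInr, mul_assoc, ← mul_assoc _ (convInl k H),
    convInlAntipode_mul_convInl, one_mul, convInrAntipode_mul_convInr]

/-- The antipode is an antimorphism of coalgebras. -/
lemma comul_antipode (h : H) : comul (R := k) (antipode k h) = swapAntipode k H (comul h) := by
  have := congr($(convInrAntipode_mul_convInlAntipode (k := k) (H := H)) h)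
  rw [(ℛ k h).convMul_apply] at this
  rw [← (ℛ k h).eq, map_sum]
  refine Eq.trans this.symm ?_
  simp

/-- `(1 ⊗ S(h₍₂₎)) Δ(S²(h₍₁₎)) = S²(h) ⊗ 1`: the image of `Δ(S(h₍₁₎)) (h₍₂₎ ⊗ 1) = 1 ⊗ S(h)` under
the antimultiplicative map `a ⊗ b ↦ S(b) ⊗ S(a)`. -/
lemma sum_antipode_mul_comul_antipode_antipode (h : H) :
    ∑ i ∈ (ℛ k h).index, ((1 : H) ⊗ₜ[k] antipode k ((ℛ k h).right i)) *
        comul (antipode k (antipode k ((ℛ k h).left i))) =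
      antipode k (antipode k h) ⊗ₜ[k] (1 : H) := by
  have : toConv (comul ∘ₗ antipode k) * convInl k H = convInrAntipode k H := by
    rw [← convInrAntipode_mul_convInlAntipode, mul_assoc, convInlAntipode_mul_convInl, mul_one]
  have := congr(swapAntipode k H ($this h))
  rw [(ℛ k h).convMul_apply] at this
  simpa [swapAntipode_mul, comul_antipode] using this

/-! ### The trace functional as a right integral -/

/-- With the basis `b`, the functional `(u, v) ↦ f(S(u) v)` splits as
`∑ⱼ bⱼ*(u) f(S(bⱼ) v)`; the sum below is therefore `y₍₁₎ f(S(y₍₂₎) y₍₃₎) = f(1) y`. -/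
lemma sum_contractSnd_comul_contractSnd_comul {ι : Type*} [Fintype ι] (b : Basis ι k H)
    (f : Dual k H) (y : H) :
    ∑ j, contractSnd (b.coord j)
      (comul (contractSnd (f ∘ₗ LinearMap.mulLeft k (antipode k (b j))) (comul y))) = f 1 • y := by
  have h1 : convInl k H * convInrAntipode k H * convInr k H = convInl k H := by
    rw [mul_assoc, convInrAntipode_mul_convInr, mul_one]
  have h2 := congr(contractSnd f ($h1 y))
  rw [(ℛ k y).convMul_apply, map_sum] at h2
  rw [convInl_apply, contractSnd_tmul] at h2
  rw [← h2]
  simp_rw [contractSnd_comul _ y, map_sum]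
  rw [Finset.sum_comm]
  refine Finset.sum_congr rfl fun i _ => ?_
  set l := (ℛ k y).left i
  set r := (ℛ k y).right i
  rw [(ℛ k l).convMul_apply, Finset.sum_mul, map_sum]
  simp_rw [map_smul]
  simp_rw [contractSnd_comul _ l, Finset.smul_sum]
  rw [Finset.sum_comm]
  refine Finset.sum_congr rfl fun m _ => ?_
  simp_rw [smul_smul, ← Finset.sum_smul]
  simp only [convInl_apply, convInrAntipode_apply, convInr_apply,
    Algebra.TensorProduct.tmul_mul_tmul, mul_one, one_mul, contractSnd_tmul]
  congr 1
  conv_rhs => rw [← b.sum_repr ((ℛ k l).right m)]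
  simp only [map_sum, map_smul, Finset.sum_mul, smul_mul_assoc, smul_eq_mul]
  refine Finset.sum_congr rfl fun j _ => ?_
  simp [mul_comm]

/-- The functional `x ↦ Tr(h ↦ S²(h) x)` on `H`. -/
noncomputable def traceIntegral (k H : Type*) [Field k] [Ring H] [HopfAlgebra k H] : Dual k H :=
  LinearMap.trace k H ∘ₗ LinearMap.lcomp k H (antipode k ∘ₗ antipode k) ∘ₗ
    (LinearMap.mul k H).flip

lemma traceIntegral_apply (x : H) :
    traceIntegral k H x =
      LinearMap.trace k H (LinearMap.mulRight k x ∘ₗ antipode k ∘ₗ antipode k) := rfl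

/-- With `z = x₍₁₎ f(x₍₂₎)`, the identity `S²(h) ⊗ 1 = (1 ⊗ S(h₍₂₎)) Δ(S²(h₍₁₎))` gives
`S²(h) z = y₍₁₎ f(S(h₍₂₎) y₍₂₎)` for `y = S²(h₍₁₎) x`. Expanding `h₍₂₎` in the basis `b` writes the
operator `h ↦ S²(h) z` as a sum of products in which `h ↦ S²(h) x` is a factor. -/
lemma mulRight_contractSnd_comul {ι : Type*} [Fintype ι] (b : Basis ι k H)
    (f : Dual k H) (x : H) :
    LinearMap.mulRight k (contractSnd f (comul x)) ∘ₗ antipode k ∘ₗ antipode k =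
      ∑ j, (contractSnd (f ∘ₗ LinearMap.mulLeft k (antipode k (b j))) ∘ₗ comul) *
        ((LinearMap.mulRight k x ∘ₗ antipode k ∘ₗ antipode k) *
          (contractSnd (b.coord j) ∘ₗ comul)) := by
  ext h
  have h1 : contractSnd f ((antipode k (antipode k h) ⊗ₜ[k] (1 : H)) * comul x) =
      antipode k (antipode k h) * contractSnd f (comul x) := by
    rw [contractSnd_mul_left]
    congr 2
    ext; simp
  rw [LinearMap.comp_apply, LinearMap.mulRight_apply, LinearMap.comp_apply, ← h1,
    ← sum_antipode_mul_comul_antipode_antipode, Finset.sum_mul, map_sum]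
  simp_rw [mul_assoc, ← Bialgebra.comul_mul, contractSnd_mul_left, one_mul]
  simp only [LinearMap.sum_apply, Module.End.mul_apply, LinearMap.comp_apply,
    contractSnd_comul _ h, map_sum, map_smul, LinearMap.mulRight_apply]
  rw [Finset.sum_comm]
  refine Finset.sum_congr rfl fun i _ => ?_
  have h5 : f ∘ₗ LinearMap.mulLeft k (antipode k ((ℛ k h).right i)) =
      ∑ j, b.coord j ((ℛ k h).right i) • (f ∘ₗ LinearMap.mulLeft k (antipode k (b j))) := by
    ext z
    conv_lhs => rw [← b.sum_repr ((ℛ k h).right i)]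
    simp only [LinearMap.comp_apply, LinearMap.mulLeft_apply, map_sum, map_smul, Finset.sum_mul,
      smul_mul_assoc, LinearMap.sum_apply, LinearMap.smul_apply, Basis.coord_apply]
  rw [h5]
  generalize comul (R := k) (antipode k (antipode k ((ℛ k h).left i)) * x) = t
  induction t with
  | zero => simp
  | tmul a c => simp [Finset.sum_smul, smul_smul]
  | add s t hs ht => simp only [map_add, smul_add, Finset.sum_add_distrib, hs, ht]

/-- The trace functional is a right integral: `λ(x₍₁₎) f(x₍₂₎) = f(1) λ(x)`. -/
lemma traceIntegral_contractSnd_comul [FiniteDimensional k H] (f : Dual k H) (x : H) :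
    traceIntegral k H (contractSnd f (comul x)) = f 1 * traceIntegral k H x := by
  let b := finBasis k H
  rw [traceIntegral_apply, mulRight_contractSnd_comul b, map_sum]
  -- Cycling the first factor to the end makes the outer factors collapse to `f(1)`.
  simp_rw [LinearMap.trace_mul_comm k (contractSnd (f ∘ₗ _) ∘ₗ comul), mul_assoc]
  rw [← map_sum, ← Finset.mul_sum]
  have : ∑ j, (contractSnd (b.coord j) ∘ₗ comul) *
      (contractSnd (f ∘ₗ LinearMap.mulLeft k (antipode k (b j))) ∘ₗ comul) =
        f 1 • (1 : Module.End k H) := by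
    ext y
    simpa using sum_contractSnd_comul_contractSnd_comul b f y
  rw [this, mul_smul_comm, mul_one, map_smul, smul_eq_mul, traceIntegral_apply]

/-- A functional `λ` with `λ(x₍₁₎) x₍₂₎ = λ(x) 1` for all `x ∈ H`: the condition of being a right
integral of `H*`, expressed in `H`. -/
def IsRightIntegralOn (l : Dual k H) : Prop :=
  ∀ x : H, contractFst l (comul x) = l x • 1

lemma isRightIntegralOn_of_forall {l : Dual k H}
    (h : ∀ (f : Dual k H) (x : H), l (contractSnd f (comul x)) = f 1 * l x) :
    IsRightIntegralOn l := by
  intro x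
  rw [← sub_eq_zero, ← Module.forall_dual_apply_eq_zero_iff k]
  intro f
  rw [map_sub, ← apply_contractSnd, h, map_smul, smul_eq_mul, mul_comm, sub_self]

lemma isRightIntegralOn_traceIntegral [FiniteDimensional k H] :
    IsRightIntegralOn (traceIntegral k H) :=
  isRightIntegralOn_of_forall traceIntegral_contractSnd_comul

lemma IsRightIntegralDual.isRightIntegralOn {l : Dual k H} (h : IsRightIntegralDual l) :
    IsRightIntegralOn l := by
  refine isRightIntegralOn_of_forall fun f x => ?_
  have := congr($(h f) x)
  rw [(ℛ k x).convMul_apply] at this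
  rw [← (ℛ k x).eq, map_sum, map_sum]
  refine Eq.trans ?_ this
  simp [mul_comm]

/-! ### Integrals and the Frobenius structure -/

/-- `e₍₁₎ ⊗ h e₍₂₎ = S(h) e₍₁₎ ⊗ e₍₂₎` for a left integral `e`. -/
lemma IsLeftIntegral.one_tmul_mul_comul {e : H} (he : IsLeftIntegral k e) (h : H) :
    ((1 : H) ⊗ₜ[k] h) * comul e = (antipode k h ⊗ₜ[k] (1 : H)) * comul e := by
  rw [← sum_antipode_mul_comul, Finset.sum_mul]
  simp_rw [mul_assoc, ← Bialgebra.comul_mul, he _, map_smul, mul_smul_comm, ← smul_mul_assoc,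
    ← Finset.sum_mul, TensorProduct.smul_tmul', ← map_smul, ← TensorProduct.sum_tmul, ← map_sum]
  congr 3
  simpa only [map_sum, TensorProduct.rid_tmul, one_smul] using
    congr(TensorProduct.rid k H $(Coalgebra.sum_tmul_counit_eq (ℛ k h)))

/-- `e₍₁₎ h ⊗ e₍₂₎ = e₍₁₎ ⊗ e₍₂₎ S(h)` for a right integral `e`. -/
lemma comul_mul_tmul_one_of_mul_eq {e : H}
    (he : ∀ h : H, e * h = counit (R := k) h • e) (h : H) :
    comul e * (h ⊗ₜ[k] (1 : H)) = comul e * ((1 : H) ⊗ₜ[k] antipode k h) := by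
  rw [← sum_comul_mul_antipode, Finset.mul_sum]
  simp_rw [← mul_assoc, ← Bialgebra.comul_mul, he _, map_smul, smul_mul_assoc, ← mul_smul_comm,
    ← Finset.mul_sum, ← TensorProduct.tmul_smul, ← map_smul, ← TensorProduct.tmul_sum, ← map_sum,
    Coalgebra.sum_counit_smul]

lemma IsLeftIntegral.contractFst_mulLeft_antipode {e : H} (he : IsLeftIntegral k e)
    (f : Dual k H) (h : H) :
    contractFst (f ∘ₗ LinearMap.mulLeft k (antipode k h)) (comul e) =
      h * contractFst f (comul e) := by
  have h1 := contractFst_mul_left f (antipode k h) 1 (comul e)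
  rw [one_mul] at h1
  rw [← h1, ← he.one_tmul_mul_comul, contractFst_mul_left]
  congr 2
  ext; simp

/-- If `λ(e) = 1`, this is the dual basis formula `h = λ(S(h) e₍₁₎) e₍₂₎`. -/
lemma IsRightIntegralOn.contractFst_mulLeft_antipode {l : Dual k H} (hl : IsRightIntegralOn l)
    {e : H} (he : IsLeftIntegral k e) (h : H) :
    contractFst (l ∘ₗ LinearMap.mulLeft k (antipode k h)) (comul e) = l e • h := by
  rw [he.contractFst_mulLeft_antipode, hl, mul_smul_comm, mul_one]

/-- On a left integral `e` the operator `h ↦ S²(h) e = ε(h) e` has rank one and trace `ε(e)`. -/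
lemma IsLeftIntegral.traceIntegral_eq_counit [FiniteDimensional k H] {e : H}
    (he : IsLeftIntegral k e) :
    traceIntegral k H e = counit (R := k) e := by
  have : LinearMap.mulRight k e ∘ₗ antipode k ∘ₗ antipode k =
      (counit (R := k) (A := H)).smulRight e := by
    ext h
    simp [he (antipode k (antipode k h))]
  rw [traceIntegral_apply, this, LinearMap.trace_smulRight]

/-- By the dual basis formula, `h` is determined by `S(h)`. -/
lemma IsLeftIntegral.antipode_bijective [FiniteDimensional k H] {e : H}
    (he : IsLeftIntegral k e) (hε : counit (R := k) e = 1) :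
    Function.Bijective (antipode k (A := H)) := by
  have hinj : Function.Injective (antipode k (A := H)) := by
    intro a b hab
    have h := fun x => isRightIntegralOn_traceIntegral.contractFst_mulLeft_antipode he x
    simp only [he.traceIntegral_eq_counit, hε, one_smul] at h
    rw [← h a, ← h b, hab]
  exact ⟨hinj, LinearMap.injective_iff_surjective.1 hinj⟩

/-- The map `f ↦ f(e₍₁₎) e₍₂₎` from `H*` to `H` is injective: it is surjective by the dual basis
formula, and both spaces have the same dimension. -/
lemma IsLeftIntegral.eq_of_contractFst_eq [FiniteDimensional k H] {e : H}
    (he : IsLeftIntegral k e) (hε : counit (R := k) e = 1) {f g : Dual k H}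
    (hfg : contractFst f (comul e) = contractFst g (comul e)) : f = g := by
  let F : Dual k H →ₗ[k] H :=
    { toFun := fun f => contractFst f (comul e)
      map_add' := fun f g => by
        generalize comul (R := k) e = t
        simp [contractFst, LinearMap.rTensor_add]
      map_smul' := fun c f => by
        generalize comul (R := k) e = t
        simp [contractFst, LinearMap.rTensor_smul] }
  have hsurj : Function.Surjective F := by
    intro h
    refine ⟨traceIntegral k H ∘ₗ LinearMap.mulLeft k (antipode k h), ?_⟩
    have := isRightIntegralOn_traceIntegral.contractFst_mulLeft_antipode he h
    rwa [he.traceIntegral_eq_counit, hε, one_smul] at this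
  exact (LinearMap.injective_iff_surjective_of_finrank_eq_finrank
    Subspace.dual_finrank_eq).2 hsurj hfg

/-- Uniqueness of integrals on `H`, with the normalisation `λ(e)` as the scalar. -/
lemma IsRightIntegralOn.eq_smul_traceIntegral [FiniteDimensional k H] {l : Dual k H}
    (hl : IsRightIntegralOn l) {e : H} (he : IsLeftIntegral k e)
    (hε : counit (R := k) e = 1) : l = l e • traceIntegral k H := by
  refine he.eq_of_contractFst_eq hε ?_
  rw [hl]
  generalize l e = c
  have : contractFst (c • traceIntegral k H) (comul e) =
      c • contractFst (traceIntegral k H) (comul e) := by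
    simp [contractFst, LinearMap.rTensor_smul]
  rw [this, isRightIntegralOn_traceIntegral, he.traceIntegral_eq_counit, hε, one_smul]

/-- Maschke: splitting off the kernel of the counit yields a left integral `e` with `ε(e) = 1`. -/
lemma exists_isLeftIntegral_counit_eq_one (k : Type*) {H : Type*} [Field k] [Ring H]
    [HopfAlgebra k H] [IsSemisimpleRing H] :
    ∃ e : H, IsLeftIntegral k e ∧ counit (R := k) e = 1 := by
  let K : Submodule H H := RingHom.ker (Bialgebra.counitAlgHom k H)
  have hK : ∀ x, x ∈ K ↔ counit (R := k) x = 0 := fun x => Iff.rfl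
  obtain ⟨J, hJ⟩ := exists_isCompl K
  obtain ⟨a, ha, e, he, hae⟩ := Submodule.mem_sup.1 (hJ.sup_eq_top ▸ Submodule.mem_top (x := 1))
  rw [hK] at ha
  have hε : counit (R := k) e = 1 := by
    have := congr(counit (R := k) $hae)
    simpa [ha] using this
  refine ⟨e, fun h => ?_, hε⟩
  have hker : (h - algebraMap k H (counit (R := k) h)) * e = 0 := by
    have h1 : (h - algebraMap k H (counit (R := k) h)) * e ∈ K := by rw [hK]; simp
    exact Submodule.disjoint_def.1 hJ.disjoint _ h1 (J.smul_mem _ he)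
  rwa [sub_mul, sub_eq_zero, ← Algebra.smul_def] at hker

/-- A left integral with `ε(e) = 1` is fixed by the antipode, hence two-sided. -/
lemma IsLeftIntegral.mul_eq [FiniteDimensional k H] {e : H}
    (he : IsLeftIntegral k e) (hε : counit (R := k) e = 1) (h : H) :
    e * h = counit (R := k) h • e := by
  have hr : ∀ h : H, antipode k e * h = counit (R := k) h • antipode k e := by
    intro h
    obtain ⟨g, rfl⟩ := (he.antipode_bijective hε).2 h
    rw [← antipode_mul_antidistrib, he, map_smul, counit_antipode]
  have hS : antipode k e = e := by
    have h1 := hr e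
    rwa [he, counit_antipode, hε, one_smul, one_smul, eq_comm] at h1
  simpa [hS] using hr h

lemma IsLeftIntegral.eq_counit_smul [FiniteDimensional k H] {e L : H}
    (he : IsLeftIntegral k e) (hε : counit (R := k) e = 1) (hL : IsLeftIntegral k L) :
    L = counit (R := k) L • e := by
  rw [← he.mul_eq hε, hL, hε, one_smul]

/-! ### The Nakayama automorphism and cocommutativity -/

section Normalized

variable [FiniteDimensional k H] {e : H} (he : IsLeftIntegral k e)
  (hε : counit (R := k) e = 1)

include he hε

lemma IsLeftIntegral.contractFst_traceIntegral_mulLeft (h : H) :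
    contractFst (traceIntegral k H ∘ₗ LinearMap.mulLeft k (antipode k h)) (comul e) = h := by
  rw [isRightIntegralOn_traceIntegral.contractFst_mulLeft_antipode he,
    he.traceIntegral_eq_counit, hε, one_smul]

lemma IsLeftIntegral.contractFst_traceIntegral_mulRight (h : H) :
    contractFst (traceIntegral k H ∘ₗ LinearMap.mulRight k h) (comul e) = antipode k h := by
  have h1 := contractFst_mul_right (traceIntegral k H) h 1 (comul e)
  rw [mul_one] at h1
  rw [← h1, comul_mul_tmul_one_of_mul_eq (he.mul_eq hε), contractFst_mul_right,
    LinearMap.mulRight_one, LinearMap.comp_id, isRightIntegralOn_traceIntegral,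
    he.traceIntegral_eq_counit, hε, one_smul, one_mul]

/-- The Nakayama automorphism of the trace functional is `S²`. -/
lemma IsLeftIntegral.traceIntegral_mul_comm (x y : H) :
    traceIntegral k H (x * y) = traceIntegral k H (antipode k (antipode k y) * x) := by
  have : traceIntegral k H ∘ₗ LinearMap.mulRight k y =
      traceIntegral k H ∘ₗ LinearMap.mulLeft k (antipode k (antipode k y)) := by
    refine he.eq_of_contractFst_eq hε ?_
    rw [he.contractFst_traceIntegral_mulRight hε, he.contractFst_traceIntegral_mulLeft hε]
  exact congr($this x)

/-- The bilinear form `(a, g) ↦ λ(a g)` of the trace functional `λ` is nondegenerate. -/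
lemma IsLeftIntegral.eq_of_traceIntegral_mul_eq {a b : H}
    (h : ∀ g, traceIntegral k H (a * g) = traceIntegral k H (b * g)) : a = b := by
  obtain ⟨a, rfl⟩ := (he.antipode_bijective hε).2 a
  obtain ⟨b, rfl⟩ := (he.antipode_bijective hε).2 b
  congr 1
  rw [← he.contractFst_traceIntegral_mulLeft hε a, ← he.contractFst_traceIntegral_mulLeft hε b]
  congr 2
  ext g
  exact h g

lemma IsLeftIntegral.traceIntegral_symm_iff :
    (∀ x y : H, traceIntegral k H (x * y) = traceIntegral k H (y * x)) ↔
      ∀ h : H, antipode k (antipode k h) = h := by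
  refine ⟨fun hs h => ?_, fun hS x y => ?_⟩
  · refine he.eq_of_traceIntegral_mul_eq hε fun g => ?_
    rw [← he.traceIntegral_mul_comm hε, hs]
  · rw [he.traceIntegral_mul_comm hε, hS]

/-- Flipping `e₍₁₎ ⊗ h e₍₂₎ = S(h) e₍₁₎ ⊗ e₍₂₎` for a cocommutative `e` gives
`h e₍₁₎ ⊗ e₍₂₎ = e₍₁₎ ⊗ S(h) e₍₂₎ = S²(h) e₍₁₎ ⊗ e₍₂₎`. -/
lemma IsLeftIntegral.antipode_antipode_of_isCocommutativeElement
    (hc : IsCocommutativeElement (comul (R := k) (A := H)) e) (h : H) :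
    antipode k (antipode k h) = h := by
  have hcomm : ∀ (a b : H) (t : H ⊗[k] H), TensorProduct.comm k H H ((a ⊗ₜ[k] b) * t) =
      (b ⊗ₜ[k] a) * TensorProduct.comm k H H t := by
    intro a b t
    induction t with
    | zero => simp
    | tmul c d => simp
    | add s t hs ht => simp only [map_add, mul_add, hs, ht]
  have h1 := congr(TensorProduct.comm k H H $(he.one_tmul_mul_comul h))
  rw [hcomm, hcomm, hc, he.one_tmul_mul_comul] at h1
  rw [← sub_eq_zero, ← Module.forall_dual_apply_eq_zero_iff k]
  intro f
  rw [map_sub, sub_eq_zero]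
  have h2 := congr(contractFst f $h1)
  rw [contractFst_mul_left, contractFst_mul_left, one_mul, one_mul] at h2
  simpa using congr($(he.eq_of_contractFst_eq hε h2) 1).symm

/-- If `S² = id`, both sides are the trace of right multiplication by `x`: the right side
when it is computed in the dual bases given by `h = λ(S(h) e₍₁₎) e₍₂₎`. -/
lemma IsLeftIntegral.traceIntegral_antipode (hS : ∀ h : H, antipode k (antipode k h) = h) (x : H) :
    traceIntegral k H x = traceIntegral k H (antipode k x) := by
  set t := traceIntegral k H with ht
  have h1 : LinearMap.mulRight k x ∘ₗ antipode k ∘ₗ antipode k = ∑ i ∈ (ℛ k e).index,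
      (t ∘ₗ LinearMap.mulRight k ((ℛ k e).left i) ∘ₗ antipode k ∘ₗ LinearMap.mulRight k x).smulRight
        ((ℛ k e).right i) := by
    ext h
    have h2 := he.contractFst_traceIntegral_mulLeft hε (h * x)
    rw [← (ℛ k e).eq, map_sum] at h2
    simp only [LinearMap.comp_apply, hS, LinearMap.mulRight_apply]
    conv_lhs => rw [← h2]
    simp [ht]
  conv_lhs => rw [ht, traceIntegral_apply, h1, map_sum]
  have h2 : ∑ i ∈ (ℛ k e).index, antipode k ((ℛ k e).right i) * (ℛ k e).left i = 1 := by
    have := congr(antipode k $(sum_antipode_mul_eq_smul (R := k) (ℛ k e)))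
    simpa [map_sum, antipode_mul_antidistrib, hS, hε] using this
  simp only [LinearMap.trace_smulRight, LinearMap.comp_apply, LinearMap.mulRight_apply,
    antipode_mul_antidistrib]
  simp_rw [mul_assoc]
  rw [← map_sum, ← Finset.mul_sum, h2, mul_one]

/-- Every functional is `λ(S(h) ·)` with `h = λ(S(h) e₍₁₎) e₍₂₎`, so it suffices that
`λ(S(h) e₍₂₎) e₍₁₎ = h`. This is tested by `λ(· g)`, where symmetry and `S`-invariance of `λ` give
`λ(S(h) e₍₂₎) λ(e₍₁₎ g) = λ(S(h) S(g)) = λ(h g)`. -/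
lemma IsLeftIntegral.isCocommutativeElement_of_antipode_antipode
    (hS : ∀ h : H, antipode k (antipode k h) = h) :
    IsCocommutativeElement (comul (R := k) (A := H)) e := by
  set t := traceIntegral k H with ht
  refine ext_contractFst fun f => ?_
  rw [contractFst_comm]
  have hf : f = t ∘ₗ LinearMap.mulLeft k (antipode k (contractFst f (comul e))) :=
    he.eq_of_contractFst_eq hε (he.contractFst_traceIntegral_mulLeft hε _).symm
  generalize contractFst f (comul e) = h at hf
  subst hf
  have hsymm := (he.traceIntegral_symm_iff hε).2 hS
  refine he.eq_of_traceIntegral_mul_eq hε fun g => ?_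
  have h1 := apply_contractSnd (t ∘ₗ LinearMap.mulLeft k (antipode k h))
    (t ∘ₗ LinearMap.mulRight k g) (comul e)
  rw [he.contractFst_traceIntegral_mulRight hε] at h1
  refine h1.trans ?_
  rw [LinearMap.comp_apply, LinearMap.mulLeft_apply, ← antipode_mul_antidistrib,
    ← he.traceIntegral_antipode hε hS, hsymm]

end Normalized

lemma isCocommutativeElement_smul_iff {C : Type*} [AddCommGroup C] [Module k C]
    (δ : C →ₗ[k] C ⊗[k] C) {a : k} (ha : a ≠ 0) (c : C) :
    IsCocommutativeElement δ (a • c) ↔ IsCocommutativeElement δ c := by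
  simp only [IsCocommutativeElement, map_smul]
  exact smul_right_injective _ ha |>.eq_iff

/-- A functional is cocommutative in `H*` exactly when it is a trace on `H`. -/
lemma isCocommutativeElement_dualComul_iff [FiniteDimensional k H] (f : Dual k H) :
    IsCocommutativeElement (dualComul k H) f ↔ ∀ x y : H, f (x * y) = f (y * x) := by
  have hcomm : ∀ (u : Dual k H ⊗[k] Dual k H) (x y : H),
      TensorProduct.dualDistrib k H H (TensorProduct.comm k _ _ u) (x ⊗ₜ[k] y) =
        TensorProduct.dualDistrib k H H u (y ⊗ₜ[k] x) := by
    intro u x y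
    induction u with
    | zero => simp
    | tmul a b => simp [mul_comm]
    | add s t hs ht => simp only [map_add, LinearMap.add_apply, hs, ht]
  refine ⟨fun h x y => ?_, fun h => ?_⟩
  · rw [← dualDistrib_dualComul f x y, ← h, hcomm, dualDistrib_dualComul]
  · refine (TensorProduct.dualDistribEquiv k H H).injective ?_
    refine TensorProduct.ext' fun x y => ?_
    refine (hcomm _ x y).trans ?_
    rw [dualDistrib_dualComul, h]
    exact (dualDistrib_dualComul f x y).symm

end

theorem mainTheorem7 {k : Type*} {H : Type*} [Field k] [IsAlgClosed k] [Ring H]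
    [HopfAlgebra k H] [FiniteDimensional k H] [IsSemisimpleRing H]
    (p : ℕ) [CharP k p] (hp : Real.sqrt (Module.finrank k H : ℝ) < (p : ℝ))
    (Λ : H) (hΛ : IsLeftIntegral k Λ) (hΛ0 : Λ ≠ 0)
    (lam : Module.Dual k H) (hlam : IsRightIntegralDual lam) (hlam0 : lam ≠ 0) :
    List.TFAE [
      IsCocommutativeElement (Coalgebra.comul (R := k) (A := H)) Λ,
      IsCocommutativeElement (dualComul k H) lam,
      (HopfAlgebra.antipode k (A := H)) ∘ₗ (HopfAlgebra.antipode k (A := H)) = LinearMap.id] := by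
  obtain ⟨e, he, hε⟩ := exists_isLeftIntegral_counit_eq_one k (H := H)
  have h1 := he.eq_counit_smul hε hΛ
  have h2 := hlam.isRightIntegralOn.eq_smul_traceIntegral he hε
  have ha : counit (R := k) Λ ≠ 0 := fun h => hΛ0 (by rw [h1, h, zero_smul])
  have hb : lam e ≠ 0 := fun h => hlam0 (by rw [h2, h, zero_smul])
  rw [h1, h2, isCocommutativeElement_smul_iff _ ha, isCocommutativeElement_smul_iff _ hb,
    isCocommutativeElement_dualComul_iff, he.traceIntegral_symm_iff hε]
  have h3 : antipode k (A := H) ∘ₗ antipode k (A := H) = LinearMap.id ↔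
      ∀ h : H, antipode k (antipode k h) = h := LinearMap.ext_iff
  rw [h3]
  tfae_have 2 ↔ 3 := Iff.rfl
  tfae_have 1 → 3 := he.antipode_antipode_of_isCocommutativeElement hε
  tfae_have 3 → 1 := he.isCocommutativeElement_of_antipode_antipode hε
  tfae_finish
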